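/- Let $n \geq 1$ and $k \geq 2$ be integers such that $k$ divides $2(n+1)$, and let $m = (n+1)(k-2)/k$, which is a nonnegative integer. For a polynomial $P$ on $\mathbb{R}^{n+1}$ let $H(P) = \det\left(\frac{\partial^2 P}{\partial x_i \partial x_j}\right)$ be its Hessian determinant. For a smooth hypersurface $\Sigma \subset \mathbb{R}^{n+1}$ and a smooth vector field $N$ along $\Sigma$ transversal to $\Sigma$, the second fundamental form $h$ of $N$ is defined by requiring that $D_X Y - h(X,Y)N$ be tangent to $\Sigma$ for all vector fields $X, Y$ tangent to $\Sigma$, where $D$ is the standard flat connection; $\Sigma$ is nondegenerate if $h$ is nondegenerate. The field $N$ is an equiaffine normal of a nondegenerate $\Sigma$ if $D_X N$ is tangent to $\Sigma$ for every $X$ tangent to $\Sigma$, and $|\det(N, X_1, \dots, X_n)|^2 = |\det (h(X_i, X_j))|$ for all $X_1, \dots, X_n$ tangent to $\Sigma$ at a common point. A connected nondegenerate hypersurface $\Sigma$ with an equiaffine normal $N$ is a proper affine sphere centred at $v$ if $v$ lies on the line $x + \mathbb{R}N_x$ for every $x \in \Sigma$. Let $P$ be a homogeneous polynomial of degree $k$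 on $\mathbb{R}^{n+1}$ (possibly zero). (1) If $H(P) = \kappa P^m$ for some real constant $\kappa \neq 0$, then for every real $r \neq 0$ each connected component of the level set $\{x \in \mathbb{R}^{n+1} : P(x) = r\}$ is a proper affine sphere centred at the origin. (2) Conversely, if $P \neq 0$ and for every real $r \neq 0$ each connected component of $\{x \in \mathbb{R}^{n+1} : P(x) = r\}$ is a proper affine sphere centred at the origin, then there is a real constant $\kappa \neq 0$ such that $H(P) = \kappa P^m$. -/

import Mathlib

open scoped ContDiff

namespace AffineSphere

/-- The Hessian determinant `det (∂²P / ∂xᵢ∂xⱼ)` of a polynomial on `ℝ^d`, as a polynomial. -/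
noncomputable def hessianDet {d : ℕ} (P : MvPolynomial (Fin d) ℝ) : MvPolynomial (Fin d) ℝ :=
  (Matrix.of fun i j => MvPolynomial.pderiv i (MvPolynomial.pderiv j P)).det

/-- The level set `{x ∈ ℝ^d : P x = r}`. -/
def levelSet {d : ℕ} (P : MvPolynomial (Fin d) ℝ) (r : ℝ) : Set (Fin d → ℝ) :=
  {x | MvPolynomial.eval x P = r}

variable {n : ℕ}

/-- `f : U → S` is a smooth local parametrization of the set `S ⊆ ℝ^{n+1}` by an open set
`U ⊆ ℝ^n`: a smooth immersion on `U` which is a homeomorphism of `U` onto a relatively open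
subset of `S` (continuous, injective, and relatively open as a map into `S`). -/
structure IsLocalParam (S : Set (Fin (n + 1) → ℝ)) (U : Set (Fin n → ℝ))
    (f : (Fin n → ℝ) → (Fin (n + 1) → ℝ)) : Prop where
  isOpen : IsOpen U
  contDiffOn : ContDiffOn ℝ ∞ f U
  immersion : ∀ u ∈ U, Function.Injective (fderiv ℝ f u)
  injOn : Set.InjOn f U
  open_image : ∀ V ⊆ U, IsOpen V → ∃ W : Set (Fin (n + 1) → ℝ), IsOpen W ∧ f '' V = S ∩ W

/-- `S` is a smooth embedded hypersurface of `ℝ^{n+1}`. -/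
def IsSmoothHypersurface (S : Set (Fin (n + 1) → ℝ)) : Prop :=
  ∀ x ∈ S, ∃ (U : Set (Fin n → ℝ)) (f : (Fin n → ℝ) → (Fin (n + 1) → ℝ)),
    IsLocalParam S U f ∧ x ∈ f '' U

/-- The tangent space of the parametrized hypersurface `f` at `f u`. -/
noncomputable def tangentAt (f : (Fin n → ℝ) → (Fin (n + 1) → ℝ)) (u : Fin n → ℝ) :
    Submodule ℝ (Fin (n + 1) → ℝ) :=
  LinearMap.range (fderiv ℝ f u : (Fin n → ℝ) →ₗ[ℝ] (Fin (n + 1) → ℝ))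

/-- The coordinate tangent vector `∂ᵢ f` at `u`. -/
noncomputable def coordVec (f : (Fin n → ℝ) → (Fin (n + 1) → ℝ)) (u : Fin n → ℝ) (i : Fin n) :
    Fin (n + 1) → ℝ :=
  fderiv ℝ f u (Pi.single i 1)

/-- `h` is the matrix, in the coordinates of `f`, of the second fundamental form at `f u`
with respect to the transversal vector `N`: the `N`-component of `∂ᵢ ∂ⱼ f` is `h i j`. -/
def IsSecondFundamentalForm (f : (Fin n → ℝ) → (Fin (n + 1) → ℝ)) (u : Fin n → ℝ)
    (N : Fin (n + 1) → ℝ) (h : Matrix (Fin n) (Fin n) ℝ) : Prop :=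
  N ∉ tangentAt f u ∧
    ∀ i j, fderiv ℝ (fderiv ℝ f) u (Pi.single i 1) (Pi.single j 1) - h i j • N ∈ tangentAt f u

/-- `Ψ(N, ∂₁ f, …, ∂ₙ f)` for the standard volume form `Ψ` of `ℝ^{n+1}`. -/
noncomputable def inducedVolume (f : (Fin n → ℝ) → (Fin (n + 1) → ℝ)) (u : Fin n → ℝ)
    (N : Fin (n + 1) → ℝ) : ℝ :=
  (Matrix.of (Fin.cons N (coordVec f u) : Fin (n + 1) → (Fin (n + 1) → ℝ))).det

/-- `N` is an equiaffine (Blaschke) normal field of the hypersurface `S`, and `S` is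
nondegenerate. In every smooth local parametrization: `N` is smooth and transversal; its second
fundamental form `h` is nondegenerate; the volume form that `N` induces on `S` is that of the
pseudo-Riemannian metric `h`; and the connection one-form of `N` vanishes (the derivatives of `N`
along `S` are tangent to `S`). Such an `N` is unique up to sign on a connected `S`; only the
values of `N` on `S` matter. -/
def IsEquiaffineNormal (S : Set (Fin (n + 1) → ℝ))
    (N : (Fin (n + 1) → ℝ) → (Fin (n + 1) → ℝ)) : Prop :=
  ∀ (U : Set (Fin n → ℝ)) (f : (Fin n → ℝ) → (Fin (n + 1) → ℝ)), IsLocalParam S U f →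
    ContDiffOn ℝ ∞ (fun u => N (f u)) U ∧
    ∀ u ∈ U,
      (∃ h : Matrix (Fin n) (Fin n) ℝ, IsSecondFundamentalForm f u (N (f u)) h ∧ h.det ≠ 0 ∧
        inducedVolume f u (N (f u)) ^ 2 = |h.det|) ∧
      ∀ X : Fin n → ℝ, fderiv ℝ (fun u => N (f u)) u X ∈ tangentAt f u

/-- `S` is a proper affine sphere with center `v`: a connected nondegenerate smooth hypersurface
all of whose equiaffine normal lines pass through the point `v`. -/
def IsProperAffineSphere (S : Set (Fin (n + 1) → ℝ)) (v : Fin (n + 1) → ℝ) : Prop :=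
  IsConnected S ∧ IsSmoothHypersurface S ∧
    ∃ N : (Fin (n + 1) → ℝ) → (Fin (n + 1) → ℝ), IsEquiaffineNormal S N ∧
      ∀ x ∈ S, ∃ s : ℝ, v = x + s • N x

end AffineSphere

/-! On a level set `P = r` with `r ≠ 0`, Euler's identity `dP_x(x) = k r ≠ 0` makes the position
vector transversal and the tangent space equal to `ker dP`. Differentiating `P ∘ f = r` twice shows
that the second fundamental form of `c • x` is the tangential Hessian divided by `-(c k r)`. Euler's
identity for the partial derivatives makes `x` Hessian-orthogonal to the tangent space. So `det Hess
P` in the frame `(c x, ∂₁f, …, ∂ₙf)` factors, and the squared frame volume times `H(P)` is an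
explicit constant times `det h` (`inducedVolume_sq_mul_hessianDet`). Hence the volume normalization
of `c • x` amounts to prescribing `|H(P)|` along the level set.

If `H(P) = κ P ^ m`, then `H(P) = κ r ^ m` on the level set, and a suitable constant `c` makes `c •
x` equiaffine. Conversely, an equiaffine normal whose lines pass through the origin is `φ • x`, and
tangency of its derivatives forces `dφ = 0`; so `|H(P)|` is constant on a patch. As `H(P)` and `P ^
m` have the same degree, `H(P)² = κ² P ^ (2m)` spreads along rays to an open set, hence holds as
polynomials, and unique signs come from the absence of zero divisors. -/

namespace AffineSphere

open MvPolynomial Matrix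

/-- The differential of the polynomial function `P` at `x`. -/
noncomputable def differential {d : ℕ} (P : MvPolynomial (Fin d) ℝ) (x : Fin d → ℝ) :
    (Fin d → ℝ) →L[ℝ] ℝ :=
  ∑ i, eval x (pderiv i P) • ContinuousLinearMap.proj i

/-- The Hessian matrix of the polynomial function `P` at `x`. -/
noncomputable def hessianAt {d : ℕ} (P : MvPolynomial (Fin d) ℝ) (x : Fin d → ℝ) :
    Matrix (Fin d) (Fin d) ℝ :=
  Matrix.of fun i j => eval x (pderiv i (pderiv j P))

/-! ### Derivatives of polynomial functions and Euler identities -/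

section Polynomial

variable {d k : ℕ} {P : MvPolynomial (Fin d) ℝ}

theorem differential_apply (P : MvPolynomial (Fin d) ℝ) (x v : Fin d → ℝ) :
    differential P x v = ∑ i, eval x (pderiv i P) * v i := by
  simp [differential]

theorem hasFDerivAt_eval (P : MvPolynomial (Fin d) ℝ) (x : Fin d → ℝ) :
    HasFDerivAt (fun y => eval y P) (differential P x) x := by
  induction P using MvPolynomial.induction_on with
  | C a =>
    simp only [eval_C]
    refine (hasFDerivAt_const a x).congr_fderiv ?_
    ext v
    simp [differential]
  | add p q hp hq =>
    simp only [map_add]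
    refine (hp.fun_add hq).congr_fderiv ?_
    ext v
    simp [differential_apply, add_mul, Finset.sum_add_distrib]
  | mul_X p i hp =>
    simp only [map_mul, eval_X]
    refine (hp.fun_mul (hasFDerivAt_apply i x)).congr_fderiv ?_
    ext v
    simp only [differential_apply, Derivation.leibniz, pderiv_X, smul_eq_mul, map_add, map_mul,
      eval_X, _root_.add_apply, _root_.smul_apply, ContinuousLinearMap.proj_apply, add_mul,
      Finset.sum_add_distrib, Finset.mul_sum]
    congr 1
    · simp [Pi.single_apply, apply_ite, Finset.sum_ite_eq]
    · exact Finset.sum_congr rfl fun j _ => by ring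

theorem contDiff_eval (P : MvPolynomial (Fin d) ℝ) : ContDiff ℝ ∞ fun y => eval y P :=
  (contDiffOn_univ.mp (AnalyticOnNhd.eval_mvPolynomial P).contDiffOn_of_completeSpace)

theorem eval_hessianDet (P : MvPolynomial (Fin d) ℝ) (x : Fin d → ℝ) :
    eval x (hessianDet P) = (hessianAt P x).det := by
  rw [hessianDet, RingHom.map_det]
  rfl

theorem eval_smul_of_isHomogeneous (hP : P.IsHomogeneous k) (t : ℝ) (x : Fin d → ℝ) :
    eval (t • x) P = t ^ k * eval x P := by
  rw [eval_eq', eval_eq', Finset.mul_sum]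
  refine Finset.sum_congr rfl fun a ha => ?_
  have hd : ∑ i, a i = k := by
    have := hP.degree_eq_sum_deg_support ha
    rw [this]
    exact (Finset.sum_subset (Finset.subset_univ _) (by simp)).symm
  simp only [Pi.smul_apply, smul_eq_mul, mul_pow, Finset.prod_mul_distrib,
    Finset.prod_pow_eq_pow_sum, hd]
  ring

theorem eval_smul_hessianDet (hP : P.IsHomogeneous k) (t : ℝ) (x : Fin d → ℝ) :
    eval (t • x) (hessianDet P) = t ^ (d * (k - 2)) * eval x (hessianDet P) := by
  have : hessianAt P (t • x) = t ^ (k - 2) • hessianAt P x := by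
    ext i j
    simp only [hessianAt, Matrix.of_apply, Matrix.smul_apply, smul_eq_mul]
    exact eval_smul_of_isHomogeneous hP.pderiv.pderiv t x
  rw [eval_hessianDet, eval_hessianDet, this, Matrix.det_smul, Fintype.card_fin, ← pow_mul,
    mul_comm d]

theorem differential_self (hP : P.IsHomogeneous k) (x : Fin d → ℝ) :
    differential P x x = k * eval x P := by
  have := congrArg (eval x) hP.sum_X_mul_pderiv
  simp only [map_sum, map_mul, eval_X, nsmul_eq_mul, map_natCast] at this
  rw [differential_apply, ← this]
  exact Finset.sum_congr rfl fun i _ => mul_comm _ _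

/-- Euler's identity for `∂ⱼP`, which is homogeneous of degree `k - 1`. -/
theorem vecMul_hessianAt_self (hP : P.IsHomogeneous k) (x : Fin d → ℝ) (j : Fin d) :
    (x ᵥ* hessianAt P x) j = (k - 1 : ℕ) * eval x (pderiv j P) := by
  rw [← differential_self (hP.pderiv (i := j)), differential_apply]
  simp [vecMul, dotProduct, hessianAt, mul_comm]

theorem vecMul_hessianAt_self_dotProduct (hP : P.IsHomogeneous k) (x v : Fin d → ℝ) :
    x ᵥ* hessianAt P x ⬝ᵥ v = (k - 1 : ℕ) * differential P x v := by
  simp only [dotProduct, vecMul_hessianAt_self hP, differential_apply, Finset.mul_sum, mul_assoc]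

end Polynomial

variable {n k : ℕ} {P : MvPolynomial (Fin (n + 1)) ℝ} {r : ℝ}
  {S : Set (Fin (n + 1) → ℝ)} {U : Set (Fin n → ℝ)} {f : (Fin n → ℝ) → (Fin (n + 1) → ℝ)}

/-! ### Geometry of a parametrized piece of a level set -/

theorem IsLocalParam.mem (hf : IsLocalParam S U f) {u : Fin n → ℝ} (hu : u ∈ U) : f u ∈ S := by
  obtain ⟨W, -, hW⟩ := hf.open_image U subset_rfl hf.isOpen
  exact (hW.subset ⟨u, hu, rfl⟩).1

theorem IsLocalParam.contDiffAt (hf : IsLocalParam S U f) {u : Fin n → ℝ} (hu : u ∈ U) :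
    ContDiffAt ℝ ∞ f u :=
  hf.contDiffOn.contDiffAt (hf.isOpen.mem_nhds hu)

theorem IsLocalParam.hasFDerivAt (hf : IsLocalParam S U f) {u : Fin n → ℝ} (hu : u ∈ U) :
    HasFDerivAt f (fderiv ℝ f u) u :=
  ((hf.contDiffAt hu).differentiableAt (by simp)).hasFDerivAt

theorem IsLocalParam.differential_fderiv (hf : IsLocalParam S U f) (hS : S ⊆ levelSet P r)
    {u : Fin n → ℝ} (hu : u ∈ U) (X : Fin n → ℝ) :
    differential P (f u) (fderiv ℝ f u X) = 0 := by
  have h1 := (hasFDerivAt_eval P (f u)).comp u (hf.hasFDerivAt hu)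
  have h2 : HasFDerivAt (fun v => eval (f v) P) (0 : (Fin n → ℝ) →L[ℝ] ℝ) u := by
    refine (hasFDerivAt_const r u).congr_of_eventuallyEq ?_
    filter_upwards [hf.isOpen.mem_nhds hu] with v hv using hS (hf.mem hv)
  exact congrArg (fun T : (Fin n → ℝ) →L[ℝ] ℝ => T X) (h1.unique h2)

/-- Differentiating `P ∘ f = r` twice. -/
theorem IsLocalParam.differential_fderiv_fderiv (hf : IsLocalParam S U f)
    (hS : S ⊆ levelSet P r) {u : Fin n → ℝ} (hu : u ∈ U) (X Y : Fin n → ℝ) :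
    differential P (f u) (fderiv ℝ (fderiv ℝ f) u X Y) =
      -(fderiv ℝ f u X ᵥ* hessianAt P (f u) ⬝ᵥ fderiv ℝ f u Y) := by
  have hdf : HasFDerivAt (fderiv ℝ f) (fderiv ℝ (fderiv ℝ f) u) u :=
    (((hf.contDiffAt hu).fderiv_right (m := ∞) le_rfl).differentiableAt
      (by simp)).hasFDerivAt
  have hY : ∀ i, HasFDerivAt (fun v => fderiv ℝ f v Y i)
      ((ContinuousLinearMap.proj i).comp ((fderiv ℝ (fderiv ℝ f) u).flip Y)) u := fun i => by
    have h := hdf.clm_apply (hasFDerivAt_const Y u)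
    have h' := (hasFDerivAt_apply (𝕜 := ℝ) i (fderiv ℝ f u Y)).comp u h
    refine h'.congr_fderiv ?_
    ext v
    simp
  have h1 := HasFDerivAt.fun_sum (u := Finset.univ) fun i _ =>
    ((hasFDerivAt_eval (pderiv i P) (f u)).comp u (hf.hasFDerivAt hu)).mul (hY i)
  have h2 : HasFDerivAt (fun v => ∑ i, eval (f v) (pderiv i P) * fderiv ℝ f v Y i)
      (0 : (Fin n → ℝ) →L[ℝ] ℝ) u := by
    refine (hasFDerivAt_const (0 : ℝ) u).congr_of_eventuallyEq ?_
    filter_upwards [hf.isOpen.mem_nhds hu] with v hv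
    rw [← differential_apply, hf.differential_fderiv hS hv]
  have h3 := congrArg (fun T : (Fin n → ℝ) →L[ℝ] ℝ => T X) (h1.unique h2)
  simp only [Function.comp_apply, _root_.sum_apply, _root_.add_apply,
    _root_.smul_apply, ContinuousLinearMap.comp_apply, ContinuousLinearMap.proj_apply,
    ContinuousLinearMap.flip_apply, smul_eq_mul, Finset.sum_add_distrib,
    _root_.zero_apply] at h3
  rw [differential_apply]
  refine eq_neg_of_add_eq_zero_left ?_
  rw [← h3]
  congr 1
  refine Finset.sum_congr rfl fun i _ => ?_
  simp only [vecMul, dotProduct, hessianAt, of_apply, differential_apply]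
  rw [mul_comm]
  congr 1
  exact Finset.sum_congr rfl fun j _ => mul_comm _ _

/-- The tangent space of a regular level set is the kernel of the differential. -/
theorem IsLocalParam.tangentAt_eq (hf : IsLocalParam S U f) (hS : S ⊆ levelSet P r)
    {u : Fin n → ℝ} (hu : u ∈ U) (hd : differential P (f u) ≠ 0) :
    tangentAt f u = LinearMap.ker (differential P (f u) : (Fin (n + 1) → ℝ) →ₗ[ℝ] ℝ) := by
  refine Submodule.eq_of_le_of_finrank_eq ?_ ?_
  · rintro _ ⟨X, rfl⟩
    exact hf.differential_fderiv hS hu X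
  · have h1 : Module.finrank ℝ (tangentAt f u) = n := by
      rw [tangentAt, LinearMap.finrank_range_of_inj (hf.immersion u hu)]
      simp
    have h2 := Module.Dual.finrank_ker_add_one_of_ne_zero
      (f := (differential P (f u) : (Fin (n + 1) → ℝ) →ₗ[ℝ] ℝ)) (by
        intro h
        apply hd
        ext v
        exact congrArg (fun T : (Fin (n + 1) → ℝ) →ₗ[ℝ] ℝ => T v) h)
    rw [Module.finrank_fin_fun] at h2
    omega

theorem IsLocalParam.mem_tangentAt_iff (hf : IsLocalParam S U f) (hS : S ⊆ levelSet P r)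
    (hP : P.IsHomogeneous k) (hk : k ≠ 0) (hr : r ≠ 0) {u : Fin n → ℝ} (hu : u ∈ U)
    (v : Fin (n + 1) → ℝ) : v ∈ tangentAt f u ↔ differential P (f u) v = 0 := by
  have h : differential P (f u) (f u) = k * r := by
    rw [differential_self hP, show eval (f u) P = r from hS (hf.mem hu)]
  rw [hf.tangentAt_eq hS hu]
  · rfl
  · intro h0
    rw [h0] at h
    exact mul_ne_zero (Nat.cast_ne_zero.mpr hk) hr h.symm

/-- The second fundamental form of a level set with respect to a multiple of the position
vector, in terms of the Hessian. -/
theorem IsLocalParam.isSecondFundamentalForm_iff (hf : IsLocalParam S U f)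
    (hS : S ⊆ levelSet P r) (hP : P.IsHomogeneous k) (hk : k ≠ 0) (hr : r ≠ 0)
    {u : Fin n → ℝ} (hu : u ∈ U) {c : ℝ} (hc : c ≠ 0) (h : Matrix (Fin n) (Fin n) ℝ) :
    IsSecondFundamentalForm f u (c • f u) h ↔
      ∀ i j, coordVec f u i ᵥ* hessianAt P (f u) ⬝ᵥ coordVec f u j = -(c * (k * r)) * h i j := by
  have hx : differential P (f u) (f u) = k * r := by
    rw [differential_self hP, show eval (f u) P = r from hS (hf.mem hu)]
  have hkr : (k * r : ℝ) ≠ 0 := mul_ne_zero (Nat.cast_ne_zero.mpr hk) hr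
  unfold IsSecondFundamentalForm
  simp only [hf.mem_tangentAt_iff hS hP hk hr hu, map_sub, map_smul, hx, smul_eq_mul,
    hf.differential_fderiv_fderiv hS hu]
  rw [and_iff_right (mul_ne_zero hc hkr)]
  refine forall₂_congr fun i j => ?_
  change -(coordVec f u i ᵥ* hessianAt P (f u) ⬝ᵥ coordVec f u j) - _ = 0 ↔ _
  constructor <;> intro h <;> linarith

/-- The volume induced by a multiple of the position vector, the Hessian determinant of `P` and
the determinant of the second fundamental form. -/
theorem IsLocalParam.inducedVolume_sq_mul_hessianDet (hf : IsLocalParam S U f)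
    (hS : S ⊆ levelSet P r) (hP : P.IsHomogeneous k) (hk : k ≠ 0) (hr : r ≠ 0)
    {u : Fin n → ℝ} (hu : u ∈ U) {c : ℝ} (hc : c ≠ 0) {h : Matrix (Fin n) (Fin n) ℝ}
    (hh : IsSecondFundamentalForm f u (c • f u) h) :
    inducedVolume f u (c • f u) ^ 2 * eval (f u) (hessianDet P) =
      c ^ 2 * ((k - 1 : ℕ) * (k * r)) * ((-(c * (k * r))) ^ n * h.det) := by
  rw [hf.isSecondFundamentalForm_iff hS hP hk hr hu hc] at hh
  have hx : differential P (f u) (f u) = k * r := by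
    rw [differential_self hP, show eval (f u) P = r from hS (hf.mem hu)]
  set A : Matrix (Fin (n + 1)) (Fin (n + 1)) ℝ :=
    Matrix.of (Fin.cons (c • f u) (coordVec f u) : Fin (n + 1) → (Fin (n + 1) → ℝ)) with hA
  -- The product is the Gram matrix of the Hessian in the frame `A`. Its first row vanishes off the
  -- diagonal, because pairing with `f u` is a multiple of `dP`, which kills tangent vectors.
  have key : ∀ i j, (A * hessianAt P (f u) * Aᵀ) i j = A i ᵥ* hessianAt P (f u) ⬝ᵥ A j := by
    intro i j
    rfl
  have h1 : inducedVolume f u (c • f u) ^ 2 * eval (f u) (hessianDet P) =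
      (A * hessianAt P (f u) * Aᵀ).det := by
    rw [det_mul, det_mul, det_transpose, eval_hessianDet, inducedVolume]
    ring
  have h00 : (A * hessianAt P (f u) * Aᵀ) 0 0 = c ^ 2 * ((k - 1 : ℕ) * (k * r)) := by
    rw [key]
    change (c • f u) ᵥ* hessianAt P (f u) ⬝ᵥ (c • f u) = _
    rw [smul_vecMul, smul_dotProduct, vecMul_hessianAt_self_dotProduct hP, map_smul, hx]
    simp only [smul_eq_mul]
    ring
  have h0s : ∀ j : Fin n, (A * hessianAt P (f u) * Aᵀ) 0 j.succ = 0 := by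
    intro j
    rw [key]
    change (c • f u) ᵥ* hessianAt P (f u) ⬝ᵥ coordVec f u j = _
    rw [smul_vecMul, smul_dotProduct, vecMul_hessianAt_self_dotProduct hP, coordVec,
      hf.differential_fderiv hS hu, mul_zero, smul_zero]
  have hss : (A * hessianAt P (f u) * Aᵀ).submatrix Fin.succ Fin.succ =
      (-(c * (k * r))) • h := by
    ext i j
    exact hh i j
  rw [h1, det_succ_row_zero, Fin.sum_univ_succ]
  simp only [h0s, h00, mul_zero, zero_mul, Finset.sum_const_zero, add_zero, Fin.val_zero,
    pow_zero, one_mul, Fin.succAbove_zero, hss, det_smul, Fintype.card_fin]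

/-- The volume of the frame formed by a transversal vector and the coordinate vectors. -/
theorem IsLocalParam.inducedVolume_ne_zero (hf : IsLocalParam S U f)
    {u : Fin n → ℝ} (hu : u ∈ U) {N : Fin (n + 1) → ℝ} (hN : N ∉ tangentAt f u) :
    inducedVolume f u N ≠ 0 := by
  have h1 : LinearIndependent ℝ (coordVec f u) := by
    have := (Pi.basisFun ℝ (Fin n)).linearIndependent.map'
      (fderiv ℝ f u : (Fin n → ℝ) →ₗ[ℝ] (Fin (n + 1) → ℝ))
      (LinearMap.ker_eq_bot.mpr (hf.immersion u hu))
    have h' : coordVec f u = (fderiv ℝ f u : (Fin n → ℝ) →ₗ[ℝ] (Fin (n + 1) → ℝ)) ∘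
        Pi.basisFun ℝ (Fin n) := by
      ext i
      simp [coordVec]
    rw [h']
    exact this
  have h2 : Submodule.span ℝ (Set.range (coordVec f u)) ≤ tangentAt f u := by
    rw [Submodule.span_le]
    rintro _ ⟨i, rfl⟩
    exact ⟨_, rfl⟩
  have h3 : LinearIndependent ℝ (Fin.cons N (coordVec f u) : Fin (n + 1) → (Fin (n + 1) → ℝ)) :=
    linearIndependent_finCons.mpr ⟨h1, fun h => hN (h2 h)⟩
  have h4 := (Matrix.linearIndependent_rows_iff_isUnit (A := Matrix.of
    (Fin.cons N (coordVec f u) : Fin (n + 1) → (Fin (n + 1) → ℝ)))).mp h3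
  exact ((Matrix.isUnit_iff_isUnit_det _).mp h4).ne_zero

/-! ### Level sets and their components as smooth hypersurfaces -/

/-- A smooth map with a differentiable left inverse on an open set is a local parametrization. -/
theorem IsLocalParam.of_leftInverse (hU : IsOpen U) (hf : ContDiffOn ℝ ∞ f U)
    {W : Set (Fin (n + 1) → ℝ)} (hW : IsOpen W) {g : (Fin (n + 1) → ℝ) → (Fin n → ℝ)}
    (hg : DifferentiableOn ℝ g W) (hfW : ∀ u ∈ U, f u ∈ S ∩ W) (hgf : ∀ u ∈ U, g (f u) = u)
    (hfg : ∀ w ∈ S ∩ W, g w ∈ U → f (g w) = w) :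
    IsLocalParam S U f where
  isOpen := hU
  contDiffOn := hf
  immersion u hu := by
    have h1 : HasFDerivAt f (fderiv ℝ f u) u :=
      ((hf.contDiffAt (hU.mem_nhds hu)).differentiableAt (by simp)).hasFDerivAt
    have h2 := (hg.differentiableAt (hW.mem_nhds (hfW u hu).2)).hasFDerivAt.comp u h1
    have h3 : HasFDerivAt (g ∘ f) (ContinuousLinearMap.id ℝ (Fin n → ℝ)) u := by
      refine (hasFDerivAt_id u).congr_of_eventuallyEq ?_
      filter_upwards [hU.mem_nhds hu] with v hv using hgf v hv
    refine Function.LeftInverse.injective (g := fderiv ℝ g (f u)) fun X => ?_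
    exact congrArg (fun T : (Fin n → ℝ) →L[ℝ] (Fin n → ℝ) => T X) (h2.unique h3)
  injOn u hu v hv h := by rw [← hgf u hu, ← hgf v hv, h]
  open_image V hVU hV := by
    refine ⟨W ∩ g ⁻¹' V, hg.continuousOn.isOpen_inter_preimage hW hV, ?_⟩
    ext w
    constructor
    · rintro ⟨u, hu, rfl⟩
      refine ⟨(hfW u (hVU hu)).1, (hfW u (hVU hu)).2, ?_⟩
      rwa [Set.mem_preimage, hgf u (hVU hu)]
    · rintro ⟨hwS, hwW, hwV⟩
      exact ⟨g w, hwV, hfg w ⟨hwS, hwW⟩ (hVU hwV)⟩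

theorem IsLocalParam.restrict (hf : IsLocalParam S U f) {T : Set (Fin (n + 1) → ℝ)}
    (hT : T ⊆ S) {B : Set (Fin n → ℝ)} (hB : IsOpen B) (hBU : B ⊆ U) (hfB : f '' B ⊆ T) :
    IsLocalParam T B f where
  isOpen := hB
  contDiffOn := hf.contDiffOn.mono hBU
  immersion u hu := hf.immersion u (hBU hu)
  injOn := hf.injOn.mono hBU
  open_image V hVB hV := by
    obtain ⟨W, hW, h⟩ := hf.open_image V (hVB.trans hBU) hV
    refine ⟨W, hW, Set.Subset.antisymm (fun w hw => ⟨hfB (Set.image_mono hVB hw), ?_⟩) ?_⟩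
    · exact (h.subset hw).2
    · rw [h]
      exact Set.inter_subset_inter_left _ hT

/-- Splitting off the line spanned by `z` along the kernel of a functional `l` with `l z = 1`. -/
theorem exists_splitting (l : (Fin (n + 1) → ℝ) →L[ℝ] ℝ) (z : Fin (n + 1) → ℝ) (hz : l z = 1) :
    ∃ (L : (Fin n → ℝ) →L[ℝ] (Fin (n + 1) → ℝ)) (M : (Fin (n + 1) → ℝ) →L[ℝ] (Fin n → ℝ)),
      (∀ u, l (L u) = 0) ∧ (∀ u, M (L u) = u) ∧ M z = 0 ∧ ∀ y, L (M y) = y - l y • z := by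
  let K : Submodule ℝ (Fin (n + 1) → ℝ) := LinearMap.ker (l : (Fin (n + 1) → ℝ) →ₗ[ℝ] ℝ)
  have hK : Module.finrank ℝ (Fin n → ℝ) = Module.finrank ℝ K := by
    have h2 := Module.Dual.finrank_ker_add_one_of_ne_zero
      (f := (l : (Fin (n + 1) → ℝ) →ₗ[ℝ] ℝ)) (by
        intro h
        have := congrArg (fun T : (Fin (n + 1) → ℝ) →ₗ[ℝ] ℝ => T z) h
        simp [hz] at this)
    rw [Module.finrank_fin_fun] at h2 ⊢
    exact (Nat.succ_injective h2).symm
  let e : (Fin n → ℝ) ≃L[ℝ] K := ContinuousLinearEquiv.ofFinrankEq hK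
  let p : (Fin (n + 1) → ℝ) →L[ℝ] K :=
    (ContinuousLinearMap.id ℝ _ - l.smulRight z).codRestrict K fun y => by
      simp [K, hz]
  have hl : ∀ u, l (e u : Fin (n + 1) → ℝ) = 0 := fun u => (e u).2
  have hp : ∀ y, (p y : Fin (n + 1) → ℝ) = y - l y • z := fun y => rfl
  refine ⟨K.subtypeL.comp (e : (Fin n → ℝ) →L[ℝ] K),
    (e.symm : K →L[ℝ] (Fin n → ℝ)).comp p, hl, fun u => ?_, ?_,
    fun y => ?_⟩
  · change e.symm (p (e u : Fin (n + 1) → ℝ)) = u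
    rw [ContinuousLinearEquiv.symm_apply_eq]
    ext1
    rw [hp, hl, zero_smul, sub_zero]
  · change e.symm (p z) = 0
    have : p z = 0 := by
      ext1
      rw [hp, hz, one_smul, sub_self]
      rfl
    rw [this, map_zero]
  · change ((e (e.symm (p y)) : K) : Fin (n + 1) → ℝ) = _
    rw [ContinuousLinearEquiv.apply_symm_apply, hp]

/-- The level set of a homogeneous polynomial is locally a radial graph over its tangent
hyperplane. -/
theorem exists_isLocalParam_levelSet (hP : P.IsHomogeneous k) (hk : k ≠ 0) (hr : r ≠ 0)
    {z : Fin (n + 1) → ℝ} (hz : z ∈ levelSet P r) :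
    ∃ (U : Set (Fin n → ℝ)) (f : (Fin n → ℝ) → (Fin (n + 1) → ℝ)),
      IsLocalParam (levelSet P r) U f ∧ (0 : Fin n → ℝ) ∈ U ∧ f 0 = z := by
  have hzr : eval z P = r := hz
  have hkr : (k * r : ℝ) ≠ 0 := mul_ne_zero (Nat.cast_ne_zero.mpr hk) hr
  let l : (Fin (n + 1) → ℝ) →L[ℝ] ℝ := (k * r : ℝ)⁻¹ • differential P z
  have hlz : l z = 1 := by
    change (k * r : ℝ)⁻¹ * differential P z z = 1
    rw [differential_self hP, hzr, inv_mul_cancel₀ hkr]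
  obtain ⟨L, M, hlL, hML, hMz, hLM⟩ := exists_splitting l z hlz
  let q : (Fin n → ℝ) → ℝ := fun u => eval (z + L u) P / r
  have hq : ContDiff ℝ ∞ q :=
    ((contDiff_eval P).comp (contDiff_const.add L.contDiff)).div_const r
  -- By homogeneity `P(t (z + L u)) = t ^ k * q u * r`, so the positive factor that brings `z + L u`
  -- to the level `r` is `q u ^ (-1/k)`.
  let t : (Fin n → ℝ) → ℝ := fun u => q u ^ (-(k : ℝ)⁻¹)
  have ht0 : ∀ u, 0 < q u → 0 < t u := fun u hu => Real.rpow_pos_of_pos hu _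
  have htk : ∀ u, 0 < q u → t u ^ k = (q u)⁻¹ := fun u hu => by
    simp only [t]
    rw [Real.rpow_neg hu.le, inv_pow, Real.rpow_inv_natCast_pow hu.le hk]
  have hl : ∀ u, l (t u • (z + L u)) = t u := fun u => by
    rw [map_smul, map_add, hlz, hlL, add_zero, smul_eq_mul, mul_one]
  have hM : ∀ u, M (t u • (z + L u)) = t u • u := fun u => by
    rw [map_smul, map_add, hMz, hML, zero_add]
  -- The inverse chart rescales `w` to `l = 1`, the affine hyperplane `z + ker l`, and reads off its
  -- coordinate there.
  have hg : ∀ w ∈ levelSet P r ∩ {w | 0 < l w},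
      z + L ((l w)⁻¹ • M w) = (l w)⁻¹ • w ∧ q ((l w)⁻¹ • M w) = (l w ^ k)⁻¹ := by
    rintro w ⟨hw, hlw : 0 < l w⟩
    have h1 : z + L ((l w)⁻¹ • M w) = (l w)⁻¹ • w := by
      rw [map_smul, hLM, smul_sub, smul_smul, inv_mul_cancel₀ hlw.ne', one_smul,
        add_sub_cancel]
    refine ⟨h1, ?_⟩
    simp only [q]
    rw [h1, eval_smul_of_isHomogeneous hP, show eval w P = r from hw, mul_div_assoc, div_self hr,
      mul_one, inv_pow]
  refine ⟨{u | 0 < q u}, fun u => t u • (z + L u),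
    IsLocalParam.of_leftInverse (W := {w | 0 < l w}) (g := fun w => (l w)⁻¹ • M w)
      (isOpen_lt continuous_const hq.continuous) ?_ (isOpen_lt continuous_const l.continuous)
      ?_ ?_ ?_ ?_, ?_, ?_⟩
  · have ht : ContDiffOn ℝ ∞ t {u | 0 < q u} :=
      hq.contDiffOn.rpow_const_of_ne fun u hu => ne_of_gt hu
    have hy : ContDiffOn ℝ ∞ (fun u => z + L u) {u | 0 < q u} :=
      (contDiff_const.add L.contDiff).contDiffOn
    exact ht.smul hy
  · intro w hw
    exact ((l.differentiableAt.inv (ne_of_gt hw)).smul M.differentiableAt).differentiableWithinAt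
  · intro u hu
    refine ⟨?_, ?_⟩
    · change eval _ P = r
      have hu' : 0 < q u := hu
      have h2 : eval (z + L u) P = q u * r := by
        simp only [q]
        field_simp
      rw [eval_smul_of_isHomogeneous hP, htk u hu, h2, inv_mul_cancel_left₀ hu'.ne']
    · change 0 < l _
      rw [hl]
      exact ht0 u hu
  · intro u hu
    rw [hl, hM, smul_smul, inv_mul_cancel₀ (ht0 u hu).ne', one_smul]
  · intro w hw _
    have hlw : 0 < l w := hw.2
    obtain ⟨h1, h2⟩ := hg w hw
    change t ((l w)⁻¹ • M w) • (z + L ((l w)⁻¹ • M w)) = w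
    have h3 : t ((l w)⁻¹ • M w) = l w := by
      simp only [t]
      rw [h2, Real.rpow_neg (by positivity), Real.inv_rpow (by positivity), inv_inv,
        Real.pow_rpow_inv_natCast hlw.le hk]
    rw [h1, h3, smul_smul, mul_inv_cancel₀ hlw.ne', one_smul]
  · change 0 < q 0
    simp [q, hzr, hr]
  · have hq0 : q 0 = 1 := by simp [q, hzr, hr]
    simp [t, hq0]

theorem isSmoothHypersurface_connectedComponentIn (hP : P.IsHomogeneous k) (hk : k ≠ 0)
    (hr : r ≠ 0) (x : Fin (n + 1) → ℝ) :
    IsSmoothHypersurface (connectedComponentIn (levelSet P r) x) := by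
  intro y hy
  obtain ⟨U, f, hf, h0, hf0⟩ :=
    exists_isLocalParam_levelSet hP hk hr (connectedComponentIn_subset _ _ hy)
  -- The image of a ball is connected, so the restricted chart stays inside the component of `y`.
  obtain ⟨ε, hε, hB⟩ := Metric.isOpen_iff.mp hf.isOpen 0 h0
  refine ⟨Metric.ball 0 ε, f, hf.restrict (connectedComponentIn_subset _ _) Metric.isOpen_ball hB
    ?_, 0, Metric.mem_ball_self hε, hf0⟩
  rw [connectedComponentIn_eq hy]
  refine IsPreconnected.subset_connectedComponentIn ?_ ⟨0, Metric.mem_ball_self hε, hf0⟩ ?_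
  · exact (convex_ball (0 : Fin n → ℝ) ε).isPreconnected.image f
      (hf.contDiffOn.continuousOn.mono hB)
  · rintro _ ⟨u, hu, rfl⟩
    exact hf.mem (hB hu)

/-! ### From the Hessian equation to affine spheres -/

/-- If the Hessian determinant is constant and nonzero on a subset `S` of a level set,
then a constant multiple of the position vector is an equiaffine normal of `S`. -/
theorem exists_isEquiaffineNormal_smul (hP : P.IsHomogeneous k) (hk : 2 ≤ k) (hr : r ≠ 0)
    (hS : S ⊆ levelSet P r) {η : ℝ} (hη : η ≠ 0) (hH : ∀ x ∈ S, eval x (hessianDet P) = η) :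
    ∃ c : ℝ, c ≠ 0 ∧ IsEquiaffineNormal S fun x => c • x := by
  have hk0 : k ≠ 0 := by omega
  have hkr : (k * r : ℝ) ≠ 0 := mul_ne_zero (Nat.cast_ne_zero.mpr hk0) hr
  have hk1 : (0 : ℝ) < (k - 1 : ℕ) := Nat.cast_pos.mpr (by omega)
  -- With `H(P) = η`, the volume identity reads `vol² * |η| = c ^ (n + 2) * a * |det h|` for `c >
  -- 0`. Thus `vol² = |det h|` requires `c ^ (n + 2) = |η| / a`.
  set a : ℝ := (k - 1 : ℕ) * |k * r| * |k * r| ^ n with ha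
  have ha0 : 0 < a := by positivity
  obtain ⟨c, hc0, hc⟩ : ∃ c : ℝ, 0 < c ∧ c ^ (n + 2) = |η| / a := by
    have hpos : 0 < |η| / a := by positivity
    refine ⟨(|η| / a) ^ (((n + 2 : ℕ) : ℝ)⁻¹), Real.rpow_pos_of_pos hpos _, ?_⟩
    exact Real.rpow_inv_natCast_pow hpos.le (by omega)
  refine ⟨c, hc0.ne', fun U f hf => ⟨hf.contDiffOn.const_smul c, fun u hu => ⟨?_, ?_⟩⟩⟩
  · have hckr : -(c * (k * r)) ≠ 0 := neg_ne_zero.mpr (mul_ne_zero hc0.ne' hkr)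
    let h : Matrix (Fin n) (Fin n) ℝ := Matrix.of fun i j =>
      (-(c * (k * r)))⁻¹ * (coordVec f u i ᵥ* hessianAt P (f u) ⬝ᵥ coordVec f u j)
    have hh : IsSecondFundamentalForm f u (c • f u) h := by
      rw [hf.isSecondFundamentalForm_iff hS hP hk0 hr hu hc0.ne']
      intro i j
      exact (mul_inv_cancel_left₀ hckr _).symm
    have hV := hf.inducedVolume_ne_zero hu hh.1
    have key := hf.inducedVolume_sq_mul_hessianDet hS hP hk0 hr hu hc0.ne' hh
    rw [hH _ (hf.mem hu)] at key
    refine ⟨h, hh, ?_, ?_⟩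
    · intro h0
      rw [h0, mul_zero, mul_zero] at key
      exact mul_ne_zero (pow_ne_zero 2 hV) hη key
    · have key' := congrArg abs key
      simp only [abs_mul, abs_pow, abs_neg, sq_abs, abs_of_pos hc0, abs_of_pos hk1] at key'
      rw [eq_div_iff ha0.ne'] at hc
      have hη' : |η| ≠ 0 := abs_ne_zero.mpr hη
      apply mul_right_cancel₀ hη'
      rw [key']
      rw [← hc, ha, abs_mul]
      ring
  · intro X
    have := ((hf.hasFDerivAt hu).const_smul c).fderiv
    change fderiv ℝ (c • f) u X ∈ _
    rw [this]
    exact (tangentAt f u).smul_mem c ⟨X, rfl⟩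

theorem isProperAffineSphere_of_hessianDet_eq {m : ℕ} (hP : P.IsHomogeneous k) (hk : 2 ≤ k)
    {κ : ℝ} (hκ : κ ≠ 0) (hH : hessianDet P = C κ * P ^ m) (hr : r ≠ 0) {x : Fin (n + 1) → ℝ}
    (hx : x ∈ levelSet P r) :
    IsProperAffineSphere (connectedComponentIn (levelSet P r) x) 0 := by
  have hS := connectedComponentIn_subset (levelSet P r) x
  obtain ⟨c, hc, hN⟩ := exists_isEquiaffineNormal_smul (η := κ * r ^ m) hP hk hr hS
    (mul_ne_zero hκ (pow_ne_zero m hr)) fun y hy => by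
      rw [hH, map_mul, eval_C, map_pow, show eval y P = r from hS hy]
  refine ⟨isConnected_connectedComponentIn_iff.mpr hx,
    isSmoothHypersurface_connectedComponentIn hP (by omega) hr x, _, hN, fun y _ => ⟨-c⁻¹, ?_⟩⟩
  rw [smul_smul, neg_mul, inv_mul_cancel₀ hc, neg_one_smul, add_neg_cancel]

/-! ### From affine spheres to the Hessian equation -/

open Topology Filter in
/-- A polynomial that vanishes on a neighbourhood of a point is zero. -/
theorem eq_zero_of_eventually_eval_eq_zero {d : ℕ} {Q : MvPolynomial (Fin d) ℝ} {x : Fin d → ℝ}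
    (h : ∀ᶠ y in 𝓝 x, eval y Q = 0) : Q = 0 := by
  obtain ⟨ε, hε, hB⟩ := Metric.eventually_nhds_iff_ball.mp h
  refine MvPolynomial.funext_set (fun i => Metric.ball (x i) ε) (fun i => ?_) fun y hy => ?_
  · rw [Real.ball_eq_Ioo]
    exact Set.Ioo_infinite (by linarith)
  · rw [map_zero]
    refine hB y ?_
    rw [ball_pi x hε]
    exact hy

open Topology Filter in
/-- A neighbourhood of a point of a level set is swept out by the rays through nearby points of
the level set. -/
theorem IsLocalParam.map_smul_nhds (hf : IsLocalParam S U f) (hS : S ⊆ levelSet P r)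
    (hP : P.IsHomogeneous k) (hk : k ≠ 0) (hr : r ≠ 0) {u : Fin n → ℝ} (hu : u ∈ U) :
    map (fun p : ℝ × (Fin n → ℝ) => p.1 • f p.2) (𝓝 (1, u)) = 𝓝 (f u) := by
  have hkr : (k * r : ℝ) ≠ 0 := mul_ne_zero (Nat.cast_ne_zero.mpr hk) hr
  have hf' : HasStrictFDerivAt f (fderiv ℝ f u) u :=
    (hf.contDiffAt hu).hasStrictFDerivAt (by simp)
  have hF := (hasStrictFDerivAt_fst (𝕜 := ℝ) (p := ((1 : ℝ), u))).fun_smul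
    (HasStrictFDerivAt.comp ((1 : ℝ), u) (g := f) hf' hasStrictFDerivAt_snd)
  have h := hF.map_nhds_eq_of_surj (by
    rw [LinearMap.range_eq_top]
    intro w
    -- The derivative at `(1, u)` sends `(s, X)` to `s • f u + df(X)`. It is onto since the position
    -- vector complements the tangent space.
    have hw : w - (differential P (f u) w / (k * r)) • f u ∈ tangentAt f u := by
      rw [hf.mem_tangentAt_iff hS hP hk hr hu, map_sub, map_smul, differential_self hP,
        show eval (f u) P = r from hS (hf.mem hu), smul_eq_mul, div_mul_cancel₀ _ hkr, sub_self]
    obtain ⟨X, hX⟩ := hw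
    refine ⟨(differential P (f u) w / (k * r), X), ?_⟩
    have hX' : fderiv ℝ f u X = w - (differential P (f u) w / (k * r)) • f u := hX
    simp [hX'])
  simpa using h

/-- The factor of proportionality between an equiaffine normal and the position vector is
stationary. -/
theorem IsLocalParam.fderiv_eq_zero_of_normal_eq_smul (hf : IsLocalParam S U f)
    (hS : S ⊆ levelSet P r) (hP : P.IsHomogeneous k) (hk : k ≠ 0) (hr : r ≠ 0)
    {N : (Fin (n + 1) → ℝ) → (Fin (n + 1) → ℝ)} (hN : IsEquiaffineNormal S N)
    {φ : (Fin n → ℝ) → ℝ} (hφ : ∀ u ∈ U, N (f u) = φ u • f u) :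
    DifferentiableOn ℝ φ U ∧ ∀ u ∈ U, fderiv ℝ φ u = 0 := by
  have hkr : (k * r : ℝ) ≠ 0 := mul_ne_zero (Nat.cast_ne_zero.mpr hk) hr
  obtain ⟨hNs, hNt⟩ := hN U f hf
  have hx : ∀ u ∈ U, differential P (f u) (f u) = k * r := fun u hu => by
    rw [differential_self hP, show eval (f u) P = r from hS (hf.mem hu)]
  have hφd : DifferentiableOn ℝ φ U := by
    -- No regularity of `φ` is assumed; it is recovered as `dP(N) / (k r)`, which is differentiable.
    have h1 : DifferentiableOn ℝ
        (fun u => (∑ i, eval (f u) (pderiv i P) * N (f u) i) * (k * r : ℝ)⁻¹) U := by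
      refine DifferentiableOn.mul_const (DifferentiableOn.fun_sum fun i _ => ?_) _
      refine DifferentiableOn.mul ?_ ?_
      · exact ((contDiff_eval (pderiv i P)).comp_contDiffOn hf.contDiffOn).differentiableOn
          (by simp)
      · exact differentiableOn_pi.mp (hNs.differentiableOn (by simp)) i
    refine h1.congr fun u hu => ?_
    rw [← differential_apply, hφ u hu, map_smul, hx u hu, smul_eq_mul, mul_inv_cancel_right₀ hkr]
  refine ⟨hφd, fun u hu => ?_⟩
  ext1 X
  have h1 := ((hφd.differentiableAt (hf.isOpen.mem_nhds hu)).hasFDerivAt).fun_smul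
    (hf.hasFDerivAt hu)
  have h2 : HasFDerivAt (fun v => N (f v)) _ u := h1.congr_of_eventuallyEq (by
    filter_upwards [hf.isOpen.mem_nhds hu] with v hv using hφ v hv)
  -- Applying `dP` to the tangent vector `φ • df(X) + dφ(X) • f` leaves `dφ(X) * k r = 0`.
  have h3 := (hNt u hu).2 X
  rw [h2.fderiv, hf.mem_tangentAt_iff hS hP hk hr hu] at h3
  simp only [_root_.add_apply, _root_.smul_apply, ContinuousLinearMap.smulRight_apply, map_add,
    map_smul, hf.differential_fderiv hS hu, hx u hu, smul_eq_mul, mul_zero, zero_add] at h3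
  exact (mul_eq_zero.mp h3).resolve_right hkr

/-- Along an affine sphere centred at the origin the Hessian determinant has locally constant
absolute value. -/
theorem IsLocalParam.exists_abs_hessianDet_eq (hf : IsLocalParam S U f)
    (hS : S ⊆ levelSet P r) (hP : P.IsHomogeneous k) (hk : 2 ≤ k) (hr : r ≠ 0)
    {N : (Fin (n + 1) → ℝ) → (Fin (n + 1) → ℝ)} (hN : IsEquiaffineNormal S N)
    (h0 : ∀ x ∈ S, ∃ s : ℝ, 0 = x + s • N x) {B : Set (Fin n → ℝ)} (hB : IsOpen B)
    (hBc : IsPreconnected B) (hBU : B ⊆ U) :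
    ∃ η : ℝ, 0 < η ∧ ∀ u ∈ B, |eval (f u) (hessianDet P)| = η := by
  have hk0 : k ≠ 0 := by omega
  have hkr : (k * r : ℝ) ≠ 0 := mul_ne_zero (Nat.cast_ne_zero.mpr hk0) hr
  have hk1 : (0 : ℝ) < (k - 1 : ℕ) := Nat.cast_pos.mpr (by omega)
  have hex : ∀ u ∈ U, ∃ a : ℝ, a ≠ 0 ∧ N (f u) = a • f u := by
    intro u hu
    obtain ⟨s, hs⟩ := h0 _ (hf.mem hu)
    have hs0 : s ≠ 0 := by
      rintro rfl
      rw [zero_smul, add_zero] at hs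
      have h1 : differential P (f u) (f u) = k * r := by
        rw [differential_self hP, show eval (f u) P = r from hS (hf.mem hu)]
      rw [← hs, map_zero] at h1
      exact hkr h1.symm
    refine ⟨-s⁻¹, neg_ne_zero.mpr (inv_ne_zero hs0), ?_⟩
    have hfu : f u = -(s • N (f u)) := eq_neg_of_add_eq_zero_left hs.symm
    conv_rhs => rw [hfu]
    rw [smul_neg, neg_smul, neg_neg, smul_smul, inv_mul_cancel₀ hs0, one_smul]
  choose! φ hφ0 hφ using hex
  obtain ⟨hd, hd0⟩ := hf.fderiv_eq_zero_of_normal_eq_smul hS hP hk0 hr hN hφ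
  obtain ⟨c, hc⟩ := hB.exists_is_const_of_fderiv_eq_zero hBc (hd.mono hBU)
    fun u hu => hd0 u (hBU hu)
  -- A point of `B` is needed to see that `c ≠ 0`; for empty `B` any positive `η` works.
  obtain rfl | ⟨u₀, hu₀⟩ := B.eq_empty_or_nonempty
  · exact ⟨1, one_pos, by simp⟩
  have hc0 : c ≠ 0 := hc u₀ hu₀ ▸ hφ0 u₀ (hBU hu₀)
  refine ⟨|c| ^ 2 * ((k - 1 : ℕ) * |k * r|) * |c * (k * r)| ^ n, by positivity, fun u hu => ?_⟩
  obtain ⟨h, hh, hdet, hvol⟩ := ((hN U f hf).2 u (hBU hu)).1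
  rw [hφ u (hBU hu), hc u hu] at hh hvol
  have key := congrArg abs
    (hf.inducedVolume_sq_mul_hessianDet hS hP hk0 hr (hBU hu) hc0 hh)
  rw [hvol] at key
  refine mul_left_cancel₀ (abs_ne_zero.mpr hdet) ?_
  rw [abs_mul, abs_abs] at key
  rw [key, abs_mul, abs_mul, abs_mul _ (k * r : ℝ), abs_mul _ h.det, abs_pow, abs_pow, abs_neg,
    Nat.abs_cast]
  ring

open Topology Filter in
-- A single affine sphere inside a single nonzero level set already determines `H(P)`.
theorem exists_hessianDet_eq {m : ℕ} (hk : 2 ≤ k) (hm : k * m = (n + 1) * (k - 2))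
    (hP : P.IsHomogeneous k) {x : Fin (n + 1) → ℝ} (hr : r ≠ 0) (hx : x ∈ S)
    (hS : S ⊆ levelSet P r) (h : IsProperAffineSphere S 0) :
    ∃ κ : ℝ, κ ≠ 0 ∧ hessianDet P = C κ * P ^ m := by
  obtain ⟨-, hSm, N, hN, h0⟩ := h
  obtain ⟨U, f, hf, u₀, hu₀, rfl⟩ := hSm x hx
  obtain ⟨ε, hε, hB⟩ := Metric.isOpen_iff.mp hf.isOpen u₀ hu₀
  obtain ⟨η, hη, hH⟩ := hf.exists_abs_hessianDet_eq hS hP hk hr hN h0 Metric.isOpen_ball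
    (convex_ball u₀ ε).isPreconnected hB
  have hrm : r ^ m ≠ 0 := pow_ne_zero m hr
  have hκ : η / r ^ m ≠ 0 := div_ne_zero hη.ne' hrm
  -- The normalization controls only `|H(P)|`, so the sign is left open: both signs enter a product,
  -- and one factor must be the zero polynomial.
  have hQ : (hessianDet P - C (η / r ^ m) * P ^ m) *
      (hessianDet P + C (η / r ^ m) * P ^ m) = 0 := by
    refine eq_zero_of_eventually_eval_eq_zero (x := f u₀) ?_
    rw [← hf.map_smul_nhds hS hP (by omega) hr hu₀, eventually_map]
    have hmem : ∀ᶠ p : ℝ × (Fin n → ℝ) in 𝓝 (1, u₀), p.2 ∈ Metric.ball u₀ ε :=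
      continuousAt_snd.eventually (Metric.ball_mem_nhds u₀ hε)
    filter_upwards [hmem] with p hp
    have h1 : eval (f p.2) (hessianDet P) ^ 2 = η ^ 2 := by rw [← hH p.2 hp, sq_abs]
    have h2 : eval (f p.2) P = r := hS (hf.mem (hB hp))
    -- Here `hm` equates the degrees: `H(P)` and `P ^ m` both scale by `p.1 ^ (k * m)`.
    simp only [map_mul, map_sub, map_add, eval_C, map_pow, eval_smul_hessianDet hP,
      eval_smul_of_isHomogeneous hP, h2, ← hm, mul_pow, ← pow_mul]
    have h3 : η / r ^ m * (p.1 ^ (k * m) * r ^ m) = p.1 ^ (k * m) * η := by field_simp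
    rw [h3]
    linear_combination (p.1 ^ (k * m)) ^ 2 * h1
  rcases mul_eq_zero.mp hQ with h | h
  · exact ⟨_, hκ, sub_eq_zero.mp h⟩
  · refine ⟨-(η / r ^ m), neg_ne_zero.mpr hκ, ?_⟩
    rw [C_neg, neg_mul]
    exact eq_neg_of_add_eq_zero_left h

end AffineSphere

/-- `hm` expresses `m = (n + 1)(k - 2) / k` without division; it also forces `k ∣ 2 (n + 1)`. -/
theorem mainTheorem2 (n k m : ℕ) (hn : 1 ≤ n) (hk : 2 ≤ k) (hm : k * m = (n + 1) * (k - 2))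
    (P : MvPolynomial (Fin (n + 1)) ℝ) (hP : P.IsHomogeneous k) :
    (∀ κ : ℝ, κ ≠ 0 → AffineSphere.hessianDet P = MvPolynomial.C κ * P ^ m →
      ∀ r : ℝ, r ≠ 0 → ∀ x ∈ AffineSphere.levelSet P r,
        AffineSphere.IsProperAffineSphere
          (connectedComponentIn (AffineSphere.levelSet P r) x) 0) ∧
    (P ≠ 0 →
      (∀ r : ℝ, r ≠ 0 → ∀ x ∈ AffineSphere.levelSet P r,
        AffineSphere.IsProperAffineSphere
          (connectedComponentIn (AffineSphere.levelSet P r) x) 0) →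
      ∃ κ : ℝ, κ ≠ 0 ∧ AffineSphere.hessianDet P = MvPolynomial.C κ * P ^ m) := by
  refine ⟨fun κ hκ hH r hr x hx =>
    AffineSphere.isProperAffineSphere_of_hessianDet_eq hP hk hκ hH hr hx, fun hP0 hsph => ?_⟩
  obtain ⟨x, hx⟩ : ∃ x, MvPolynomial.eval x P ≠ 0 := by
    by_contra! h
    exact hP0 (MvPolynomial.funext fun x => by rw [h x, map_zero])
  exact AffineSphere.exists_hessianDet_eq hk hm hP hx
    (mem_connectedComponentIn (F := AffineSphere.levelSet P (MvPolynomial.eval x P)) rfl)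
    (connectedComponentIn_subset _ _) (hsph _ hx x rfl)
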